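/- **Setting.** A composition is a finite sequence $\alpha=[\alpha_1,\dots,\alpha_m]$ of positive integers ($m\ge 0$); $|\alpha|=\sum_i\alpha_i$, and $\gamma\models n$ means that $\gamma$ is a composition with $|\gamma|=n$. $\mathsf{NSym}$ is the free associative $\mathbb{Q}$-algebra on $H_1,H_2,\dots$, with basis $H_\alpha=H_{\alpha_1}\cdots H_{\alpha_m}$, and $H_0=1$, $H_{r}=0$ for $r<0$. $\mathsf{QSym}$ is the algebra of quasi-symmetric functions over $\mathbb{Q}$, with monomial basis $M_\alpha$, paired with $\mathsf{NSym}$ by $\langle H_\alpha,M_\beta\rangle=\delta_{\alpha,\beta}$. For $F\in\mathsf{QSym}$, $F^\perp$ is the operator on $\mathsf{NSym}$ with $\langle F^\perp X,G\rangle=\langle X,FG\rangle$ for all $G\in\mathsf{QSym}$. Let $F_r=\sum_{\alpha\models r}M_\alpha$ and $F_{1^i}=M_{[1,\dots,1]}$ ($i$ ones) be the fundamental quasi-symmetric functions of $[r]$ and $[1,\dots,1]$. For $m\in\mathbb{Z}$ let $\mathbb{B}_m(X)=\sum_{i\ge 0}(-1)^iH_{m+i}\,F_{1^i}^\perp(X)$,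 and let $\mathfrak{S}_\alpha=\mathbb{B}_{\alpha_1}\mathbb{B}_{\alpha_2}\cdots\mathbb{B}_{\alpha_m}(1)$ be the immaculate function of $\alpha$. For a positive integer $s$ and a composition $\alpha$ of length $m$, let $Z_{s,\alpha}$ be the set of all $\beta\in\mathbb{Z}^m$ such that 1. $\beta_1+\dots+\beta_m=s$ and $\beta_1+\dots+\beta_i\le s$ for all $i$; 2. $\alpha_i-\beta_i\ge 0$ for all $i$, with equality for at most one $i$; 3. for every $i$, with $R_i=s-(\beta_1+\dots+\beta_{i-1})$: if $\alpha_i>R_i$ then $0\le\beta_i\le R_i$; if $\alpha_i=R_i$ then either $\beta_i=\alpha_i$ and $\beta_{j}=0$ for all $j>i$, or $\beta_i<0$; if $\alpha_i<R_i$ then $\beta_i<0$. For a composition $\gamma$, put $$c_{s,\alpha}^{\gamma}=\sum_{\beta}(-1)^{\#\{i\,:\,\beta_i<0\}},$$ the (finite) sum over those $\beta\in Z_{s,\alpha}$ for which deleting the zero entries of $\alpha-\beta$ gives $\gamma$. **Corollary.** Let $\lambda=[\lambda_1,\dots,\lambda_m]$ be a partition, i.e. a weakly decreasing composition (with $\lambda_1=0$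 if $\lambda$ is empty), let $s$ be a positive integer, and let $\operatorname{tail}(\lambda)=[\lambda_2,\dots,\lambda_m]$. Then $$F_s^\perp\mathfrak{S}_\lambda=\begin{cases}0&\text{if }\lambda_1<s,\\ \mathfrak{S}_{\operatorname{tail}(\lambda)}&\text{if }\lambda_1=s,\\ \displaystyle\sum_{\gamma\models|\lambda|-s}c_{s,\lambda}^{\gamma}\,\mathfrak{S}_\gamma&\text{if }\lambda_1>s,\end{cases}$$ and in the last case $c_{s,\lambda}^{\gamma}\in\{0,1\}$ for every $\gamma\models|\lambda|-s$. Moreover the family $(\mathfrak{S}_\gamma)$, over all compositions $\gamma$, is linearly independent, so that these are the coefficients of the expansion in immaculate functions, which is therefore positive and multiplicity free. -/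

import Mathlib

namespace NCSym

noncomputable section

/-! Compositions are lists of positive integers. -/

/-- The size `|α|` of a composition `α`. -/
def size (α : List ℕ+) : ℕ := (α.map fun a => (a : ℕ)).sum

/-- The finite set of compositions of `n` (see `mem_compositions`). -/
def compositions : ℕ → Finset (List ℕ+)
  | 0 => {[]}
  | n + 1 => Finset.univ.biUnion fun i : Fin (n + 1) =>
      (compositions (n - i)).image fun γ => Nat.succPNat i :: γ

@[simp] theorem size_nil : size [] = 0 := rfl

@[simp] theorem size_cons (a : ℕ+) (α : List ℕ+) : size (a :: α) = a + size α := by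
  simp [size]

theorem mem_compositions (γ : List ℕ+) : ∀ n : ℕ, γ ∈ compositions n ↔ size γ = n := by
  induction γ with
  | nil =>
    intro n
    cases n with
    | zero => simp [compositions]
    | succ n => simp [compositions]
  | cons a γ ih =>
    intro n
    have ha := a.pos
    cases n with
    | zero => simp [compositions]
    | succ n =>
      rw [compositions, size_cons]
      simp only [Finset.mem_biUnion, Finset.mem_univ, true_and, Finset.mem_image, List.cons.injEq]
      constructor
      · rintro ⟨i, γ', h, rfl, rfl⟩
        rw [ih] at h
        have := i.isLt
        simp only [Nat.succPNat_coe]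
        omega
      · intro h
        refine ⟨⟨a - 1, by omega⟩, γ, ?_, ?_, rfl⟩
        · rw [ih]
          simp only
          omega
        · apply PNat.coe_injective
          simp only [Nat.succPNat_coe]
          omega

/-- The subset `D(α) = {α₁, α₁ + α₂, …, α₁ + ⋯ + αₘ₋₁}` attached to `α = [α₁, …, αₘ]`. -/
def descentSet (α : List ℕ+) : Finset ℕ :=
  (Finset.Ico 1 α.length).image fun k => size (α.take k)

/-- A composition viewed as a tuple of integers. -/
def toInts (α : List ℕ+) : List ℤ := α.map fun a => ((a : ℕ) : ℤ)

/-- The first part, with the convention that it is `0` for the empty composition. -/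
def firstPart : List ℕ+ → ℕ
  | [] => 0
  | a :: _ => a

/-- A partition is a weakly decreasing composition. -/
def IsPartition (α : List ℕ+) : Prop := α.Pairwise (· ≥ ·)

/-! ### Non-commutative symmetric functions -/

/-- The algebra `NSym`: free associative `ℚ`-algebra on generators `H₁, H₂, …`. -/
abbrev NSym : Type := FreeAlgebra ℚ ℕ+

/-- `H m` for an integer `m`: the generator if `m > 0`, and `H 0 = 1`, `H m = 0` if `m < 0`. -/
def H (m : ℤ) : NSym :=
  if h : 0 < m then FreeAlgebra.ι ℚ (⟨m.toNat, by omega⟩ : ℕ+) else if m = 0 then 1 else 0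

/-- The complete homogeneous function `H_α = H_{α₁} ⋯ H_{αₘ}`. -/
def completeH (α : List ℕ+) : NSym := (α.map (FreeAlgebra.ι ℚ)).prod

/-- The basis `(H_α)` of `NSym` indexed by all compositions (see `basisH_apply`). -/
def basisH : Module.Basis (List ℕ+) ℚ NSym :=
  (FreeAlgebra.basisFreeMonoid ℚ ℕ+).reindex FreeMonoid.toList

theorem basisH_apply (α : List ℕ+) : basisH α = completeH α := by
  simp only [basisH, Module.Basis.reindex_apply, FreeAlgebra.basisFreeMonoid, completeH]
  simp [FreeAlgebra.equivMonoidAlgebraFreeMonoid, FreeMonoid.lift_apply]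

/-! ### Quasi-symmetric functions -/

/-- The space `QSym`, the graded dual of `NSym`: finite linear combinations of the monomial
quasi-symmetric functions `M_α`. -/
def QSym : Type := List ℕ+ →₀ ℚ

instance : AddCommGroup QSym := inferInstanceAs (AddCommGroup (List ℕ+ →₀ ℚ))

instance : Module ℚ QSym := inferInstanceAs (Module ℚ (List ℕ+ →₀ ℚ))

/-- The monomial basis of `QSym`. -/
def basisM : Module.Basis (List ℕ+) ℚ QSym := Module.Basis.ofRepr (LinearEquiv.refl ℚ _)

/-- The monomial quasi-symmetric function `M_α = ∑_{i₁ < ⋯ < iₘ} x_{i₁}^{α₁} ⋯ x_{iₘ}^{αₘ}`. -/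
def M (α : List ℕ+) : QSym := basisM α

/-- The linear map `M_α ↦ M_{[a, α]}`. -/
def consM (a : ℕ+) : QSym →ₗ[ℚ] QSym := basisM.constr ℚ fun α => M (a :: α)

/-- The product `M_α M_β`, by the quasi-shuffle rule for multiplying
monomial quasi-symmetric functions. -/
def quasiShuffle : List ℕ+ → List ℕ+ → QSym
  | [], β => M β
  | a :: α, [] => M (a :: α)
  | a :: α, b :: β =>
      consM a (quasiShuffle α (b :: β)) + consM b (quasiShuffle (a :: α) β)
        + consM (a + b) (quasiShuffle α β)
  termination_by α β => α.length + β.length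

/-- The product of `QSym` as a bilinear map. -/
def mulQ : QSym →ₗ[ℚ] QSym →ₗ[ℚ] QSym :=
  basisM.constr ℚ fun α => basisM.constr ℚ fun β => quasiShuffle α β

instance : Mul QSym := ⟨fun F G => mulQ F G⟩

theorem mul_def (F G : QSym) : F * G = mulQ F G := rfl

theorem M_mul_M (α β : List ℕ+) : M α * M β = quasiShuffle α β := by
  simp [mul_def, mulQ, M, Module.Basis.constr_basis]

/-- The fundamental quasi-symmetric function `F_α = ∑_{β ≤ α} M_β`, where `β ≤ α`
(refinement) means `|β| = |α|` and `D(α) ⊆ D(β)`. -/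
def fundamental (α : List ℕ+) : QSym :=
  ∑ β ∈ (compositions (size α)).filter fun β => descentSet α ⊆ descentSet β, M β

/-! ### Duality -/

/-- The bilinear pairing with `⟨H_α, M_β⟩ = δ_{α,β}`. -/
def pairing : NSym →ₗ[ℚ] QSym →ₗ[ℚ] ℚ :=
  basisH.constr ℚ fun α => basisM.coord α

theorem pairing_completeH_M (α β : List ℕ+) :
    pairing (completeH α) (M β) = if α = β then 1 else 0 := by
  rw [← basisH_apply, pairing, Module.Basis.constr_basis, M, Module.Basis.coord_apply,
    Module.Basis.repr_self, Finsupp.single_apply]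
  simp only [eq_comm]

/-- The operator `F^⊥` on `NSym`, given on the basis by
`F^⊥ H_α = ∑_γ ⟨H_α, F M_γ⟩ H_γ`; only the `γ` with `|γ| ≤ |α|` contribute.
It is the adjoint of multiplication by `F` (see `pairing_perp`). -/
def perp (F : QSym) : NSym →ₗ[ℚ] NSym :=
  basisH.constr ℚ fun α =>
    ∑ k ∈ Finset.range (size α + 1), ∑ γ ∈ compositions k,
      pairing (completeH α) (F * M γ) • completeH γ

theorem pairing_consM_nil (a : ℕ+) (G : QSym) : pairing (completeH []) (consM a G) = 0 := by
  have : (pairing (completeH [])) ∘ₗ consM a = 0 := by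
    apply basisM.ext
    intro β
    simp [consM, Module.Basis.constr_basis, pairing_completeH_M]
  exact LinearMap.congr_fun this G

theorem pairing_consM_cons (a b : ℕ+) (α : List ℕ+) (G : QSym) :
    pairing (completeH (a :: α)) (consM b G) = if a = b then pairing (completeH α) G else 0 := by
  have : (pairing (completeH (a :: α))) ∘ₗ consM b
      = if a = b then pairing (completeH α) else 0 := by
    apply basisM.ext
    intro β
    rw [LinearMap.comp_apply, consM, Module.Basis.constr_basis, pairing_completeH_M]
    have hM : basisM β = M β := rfl
    rw [hM]
    by_cases h : a = b <;> simp [pairing_completeH_M, h]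
  have h2 := LinearMap.congr_fun this G
  by_cases h : a = b <;> simpa [h] using h2

theorem pairing_quasiShuffle (γ : List ℕ+) : ∀ α β : List ℕ+,
    size γ ≠ size α + size β → pairing (completeH γ) (quasiShuffle α β) = 0 := by
  induction γ with
  | nil =>
    intro α β h
    match α, β with
    | [], β =>
      rw [quasiShuffle, pairing_completeH_M, if_neg]
      rintro rfl
      simp at h
    | a :: α, [] => rw [quasiShuffle, pairing_completeH_M, if_neg (by simp)]
    | a :: α, b :: β => rw [quasiShuffle]; simp only [map_add, pairing_consM_nil, add_zero]
  | cons c γ ih =>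
    intro α β h
    match α, β with
    | [], β =>
      rw [quasiShuffle, pairing_completeH_M, if_neg]
      rintro rfl
      simp at h
    | a :: α, [] =>
      rw [quasiShuffle, pairing_completeH_M, if_neg]
      intro h1
      rw [h1] at h
      simp at h
    | a :: α, b :: β =>
      rw [quasiShuffle]
      simp only [map_add, pairing_consM_cons]
      simp only [size_cons] at h
      have e1 : (if c = a then pairing (completeH γ) (quasiShuffle α (b :: β)) else 0) = 0 := by
        split_ifs with hc
        · exact ih _ _ (by rw [hc] at h; simp only [size_cons]; omega)
        · rfl
      have e2 : (if c = b then pairing (completeH γ) (quasiShuffle (a :: α) β) else 0) = 0 := by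
        split_ifs with hc
        · exact ih _ _ (by rw [hc] at h; simp only [size_cons]; omega)
        · rfl
      have e3 : (if c = a + b then pairing (completeH γ) (quasiShuffle α β) else 0) = 0 := by
        split_ifs with hc
        · exact ih _ _ (by rw [hc, PNat.add_coe] at h; omega)
        · rfl
      rw [e1, e2, e3]
      simp

theorem pairing_mul_M_of_lt (α γ : List ℕ+) (F : QSym) (h : size α < size γ) :
    pairing (completeH α) (F * M γ) = 0 := by
  have : (pairing (completeH α)) ∘ₗ (mulQ.flip (M γ)) = 0 := by
    apply basisM.ext
    intro β
    have hM : mulQ (basisM β) (M γ) = quasiShuffle β γ := M_mul_M β γ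
    simp only [LinearMap.comp_apply, LinearMap.flip_apply, hM, LinearMap.zero_apply]
    exact pairing_quasiShuffle _ _ _ (by omega)
  exact LinearMap.congr_fun this F

/-- `F^⊥` is adjoint to multiplication by `F`. -/
theorem pairing_perp (F G : QSym) (X : NSym) : pairing (perp F X) G = pairing X (F * G) := by
  have key : ∀ α γ : List ℕ+,
      pairing (perp F (completeH α)) (M γ) = pairing (completeH α) (F * M γ) := by
    intro α γ
    rw [← basisH_apply, perp, Module.Basis.constr_basis, basisH_apply]
    simp only [map_sum, map_smul, LinearMap.sum_apply, LinearMap.smul_apply,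
      pairing_completeH_M, smul_eq_mul, mul_ite, mul_one, mul_zero]
    simp only [Finset.sum_ite_eq', mem_compositions]
    rw [Finset.sum_ite_eq]
    split_ifs with h
    · rfl
    · rw [pairing_mul_M_of_lt]
      simp at h
      omega
  have : pairing ∘ₗ perp F = (LinearMap.lcomp ℚ ℚ (mulQ F)) ∘ₗ pairing := by
    apply basisH.ext
    intro α
    apply basisM.ext
    intro γ
    rw [LinearMap.comp_apply, LinearMap.comp_apply, LinearMap.lcomp_apply, basisH_apply]
    exact key α γ
  exact LinearMap.congr_fun (LinearMap.congr_fun this X) G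

/-! ### The immaculate functions -/

/-- The non-commutative Bernstein operator `𝔹_m = ∑_{i ≥ 0} (-1)^i H_{m+i} F_{1^i}^⊥`.
On every element only finitely many summands are nonzero (see `bernstein_support_finite`). -/
def bernstein (m : ℤ) (X : NSym) : NSym :=
  ∑ᶠ i : ℕ, (-1 : ℚ) ^ i • (H (m + i) * perp (fundamental (List.replicate i 1)) X)

theorem perp_fundamental_eq_zero (α β : List ℕ+) (h : size β < size α) :
    perp (fundamental α) (completeH β) = 0 := by
  rw [← basisH_apply, perp, Module.Basis.constr_basis]
  refine Finset.sum_eq_zero fun k _ => Finset.sum_eq_zero fun γ _ => ?_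
  have : pairing (completeH β) (fundamental α * M γ) = 0 := by
    rw [mul_def, fundamental, map_sum, LinearMap.sum_apply, map_sum]
    refine Finset.sum_eq_zero fun δ hδ => ?_
    rw [Finset.mem_filter, mem_compositions] at hδ
    rw [← mul_def, M_mul_M]
    exact pairing_quasiShuffle _ _ _ (by omega)
  rw [this, zero_smul]

theorem bernstein_support_finite (m : ℤ) (X : NSym) :
    (Function.support fun i : ℕ =>
      (-1 : ℚ) ^ i • (H (m + i) * perp (fundamental (List.replicate i 1)) X)).Finite := by
  have hsz : ∀ i : ℕ, size (List.replicate i 1) = i := by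
    intro i
    induction i with
    | zero => rfl
    | succ i ih => rw [List.replicate_succ, size_cons, ih, PNat.one_coe, add_comm]
  refine Set.Finite.subset
    (Finset.range ((basisH.repr X).support.sup size + 1)).finite_toSet ?_
  intro i hi
  rw [Finset.mem_coe, Finset.mem_range]
  by_contra hlt
  apply hi
  have : perp (fundamental (List.replicate i 1)) X = 0 := by
    rw [← basisH.linearCombination_repr X, Finsupp.linearCombination_apply, Finsupp.sum, map_sum]
    refine Finset.sum_eq_zero fun β hβ => ?_
    have hle : size β ≤ (basisH.repr X).support.sup size := Finset.le_sup hβ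
    rw [map_smul, basisH_apply, perp_fundamental_eq_zero _ _ (by rw [hsz]; omega), smul_zero]
  simp only [this, mul_zero, smul_zero]

/-- The immaculate function `𝔖_α = 𝔹_{α₁} ⋯ 𝔹_{αₘ}(1)` of a tuple of integers. -/
def immaculate (α : List ℤ) : NSym := α.foldr bernstein 1

/-! ### The coefficients -/

/-- Membership of an integer sequence `β`, of the same length as `α`, in the set `Z_{s,α}`.
Here `s - ∑ j ∈ Finset.Iio i, β j` is `s - (β₁ + ⋯ + β_{i-1})`. -/
structure InZ (s : ℕ) (α : List ℕ+) (β : Fin α.length → ℤ) : Prop where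
  sum_eq : ∑ i, β i = s
  sum_le : ∀ i, ∑ j ∈ Finset.Iic i, β j ≤ s
  nonneg : ∀ i, 0 ≤ ((α.get i : ℕ) : ℤ) - β i
  zero_unique : ∀ i j, ((α.get i : ℕ) : ℤ) - β i = 0 → ((α.get j : ℕ) : ℤ) - β j = 0 → i = j
  of_gt : ∀ i, s - ∑ j ∈ Finset.Iio i, β j < ((α.get i : ℕ) : ℤ) →
    0 ≤ β i ∧ β i ≤ s - ∑ j ∈ Finset.Iio i, β j
  of_eq : ∀ i, ((α.get i : ℕ) : ℤ) = s - ∑ j ∈ Finset.Iio i, β j →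
    (β i = ((α.get i : ℕ) : ℤ) ∧ ∀ j, i < j → β j = 0) ∨ β i < 0
  of_lt : ∀ i, ((α.get i : ℕ) : ℤ) < s - ∑ j ∈ Finset.Iio i, β j → β i < 0

/-- `α - β` with its zero entries removed. -/
def compDiff (α : List ℕ+) (β : Fin α.length → ℤ) : List ℤ :=
  (List.ofFn fun i => ((α.get i : ℕ) : ℤ) - β i).filter fun x => x ≠ 0

/-- `Z_{s,α}^γ`, the set of `β ∈ Z_{s,α}` with `comp(α - β) = γ`. -/
def setZ (s : ℕ) (α γ : List ℕ+) : Set (Fin α.length → ℤ) :=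
  {β | InZ s α β ∧ compDiff α β = toInts γ}

/-- `(-1)` to the number of negative entries of `β`. -/
def sgn {m : ℕ} (β : Fin m → ℤ) : ℤ := (-1) ^ (Finset.univ.filter fun i => β i < 0).card

/-- `c_{s,α}^γ = ∑_{β ∈ Z_{s,α}^γ} sgn(β)`, a finite sum (see `setZ_finite`). -/
def coeffC (s : ℕ) (α γ : List ℕ+) : ℤ := ∑ᶠ β ∈ setZ s α γ, sgn β

theorem setZ_finite (s : ℕ) (α γ : List ℕ+) : (setZ s α γ).Finite := by
  refine Set.Finite.subset (Set.finite_Icc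
    (fun _ => (s : ℤ) - ∑ j : Fin α.length, ((α.get j : ℕ) : ℤ))
    (fun i : Fin α.length => ((α.get i : ℕ) : ℤ))) ?_
  rintro β ⟨h, -⟩
  refine ⟨fun i => ?_, fun i => ?_⟩
  · have h1 := h.sum_eq
    have h2 : ((α.get i : ℕ) : ℤ) - β i ≤ ∑ j, (((α.get j : ℕ) : ℤ) - β j) :=
      Finset.single_le_sum (f := fun j => ((α.get j : ℕ) : ℤ) - β j)
        (fun j _ => h.nonneg j) (Finset.mem_univ i)
    rw [Finset.sum_sub_distrib] at h2
    have h3 : (0 : ℤ) ≤ ((α.get i : ℕ) : ℤ) := Int.natCast_nonneg _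
    simp only
    linarith
  · have := h.nonneg i
    simp only
    linarith

end

end NCSym

open NCSym

namespace NCSym

/-! Write F_n^⊥ for `perpRow n` and F_{1^i}^⊥ for `perpCol i`. Pairing with monomial functions turns
the quasi-shuffle rule into Leibniz rules for moving these operators past H_a (`perpRow_H_mul`,
`perpCol_succ_H_mul`). From these rules the two families commute and satisfy the antipode relation,
and two facts about Bernstein operators follow: F_s^⊥ 𝔹_a = ∑_k 𝔹_{a-k} F_{s-k}^⊥
(`perpRow_bernstein`), and ∑_n 𝔹_{t+n} F_n^⊥ X = H_t X when the sum is finite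
(`sum_bernstein_perpRow`).

If F_n^⊥ X = 0 for all n > s, the two combine to F_s^⊥ 𝔹_a X = H_{a-s} X. For X = 𝔖_tail(λ) and a =
λ₁ this gives 0 when λ₁ < s and 𝔖_tail(λ) when λ₁ = s. When λ₁ > s the first fact is a recursion on
the first part, whose outcome is recorded by `pieriSet` (`perpRow_immaculate`).

On the combinatorial side, a negative entry of β ∈ Z_{s,λ} enlarges the remainder R. For a partition
the later parts are then all smaller than R, so the entries stay negative and the sum never reaches
s (`not_inZ_of_lt`). Hence every sign is +1. Each γ determines its β entry by entry, so the
coefficient is the indicator function of `pieriSet` (`coeffC_eq`). Linear independence comes from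
unitriangularity against the H basis (`pairing_immaculate`). -/

/-! ### Left multiplication by H_j and the pairing -/

theorem completeH_nil : completeH [] = 1 := rfl

theorem completeH_cons (a : ℕ+) (α : List ℕ+) :
    completeH (a :: α) = FreeAlgebra.ι ℚ a * completeH α := by
  simp [completeH]

theorem H_coe (a : ℕ+) : H ((a : ℕ) : ℤ) = FreeAlgebra.ι ℚ a := by
  have := a.pos
  rw [H, dif_pos (by exact_mod_cast this)]
  congr 1

theorem H_zero : H 0 = 1 := by simp [H]

theorem H_of_neg {m : ℤ} (h : m < 0) : H m = 0 := by
  rw [H, dif_neg (by omega), if_neg (by omega)]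

theorem H_cases (m : ℤ) : m < 0 ∨ m = 0 ∨ ∃ a : ℕ+, m = ((a : ℕ) : ℤ) := by
  rcases lt_trichotomy m 0 with h | h | h
  · exact Or.inl h
  · exact Or.inr (Or.inl h)
  · exact Or.inr (Or.inr ⟨⟨m.toNat, by omega⟩, by simp only [PNat.mk_coe]; omega⟩)

/-- Two linear maps on `NSym` agree as soon as they agree on all words in the generators. -/
theorem linearMap_ext {V : Type*} [AddCommGroup V] [Module ℚ V] {f g : NSym →ₗ[ℚ] V}
    (h : ∀ α, f (completeH α) = g (completeH α)) : f = g :=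
  basisH.ext fun α => by rw [basisH_apply]; exact h α

/-- The pairing with the monomial functions separates points of `NSym`. -/
theorem ext_pairing {X Y : NSym} (h : ∀ γ, pairing X (M γ) = pairing Y (M γ)) : X = Y := by
  have key : ∀ (Z : NSym) γ, pairing Z (M γ) = basisH.repr Z γ := by
    intro Z γ
    have : pairing.flip (M γ) = basisH.coord γ := by
      apply linearMap_ext
      intro α
      rw [LinearMap.flip_apply, pairing_completeH_M, ← basisH_apply, Module.Basis.coord_apply,
        Module.Basis.repr_self, Finsupp.single_apply]
    exact LinearMap.congr_fun this Z
  apply basisH.repr.injective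
  ext γ
  rw [← key, ← key, h]

theorem pairing_ι_mul_nil (a : ℕ+) (Z : NSym) :
    pairing (FreeAlgebra.ι ℚ a * Z) (M []) = 0 := by
  have : pairing.flip (M []) ∘ₗ LinearMap.mulLeft ℚ (FreeAlgebra.ι ℚ a) = 0 := by
    apply linearMap_ext
    intro α
    simp [← completeH_cons, pairing_completeH_M]
  exact LinearMap.congr_fun this Z

theorem pairing_ι_mul_cons (a c : ℕ+) (γ : List ℕ+) (Z : NSym) :
    pairing (FreeAlgebra.ι ℚ a * Z) (M (c :: γ)) = if a = c then pairing Z (M γ) else 0 := by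
  have : pairing.flip (M (c :: γ)) ∘ₗ LinearMap.mulLeft ℚ (FreeAlgebra.ι ℚ a)
      = if a = c then pairing.flip (M γ) else 0 := by
    apply linearMap_ext
    intro α
    split_ifs with h <;> simp [← completeH_cons, pairing_completeH_M, h]
  have h2 := LinearMap.congr_fun this Z
  split_ifs at h2 ⊢ with h <;> simpa using h2

theorem pairing_H_mul_nil (j : ℤ) (Z : NSym) :
    pairing (H j * Z) (M []) = if j = 0 then pairing Z (M []) else 0 := by
  rcases H_cases j with h | rfl | ⟨a, rfl⟩
  · rw [H_of_neg h, if_neg h.ne]; simp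
  · rw [H_zero, one_mul, if_pos rfl]
  · rw [H_coe, pairing_ι_mul_nil, if_neg (by exact_mod_cast a.ne_zero)]

theorem pairing_H_mul_cons (j : ℤ) (c : ℕ+) (γ : List ℕ+) (Z : NSym) :
    pairing (H j * Z) (M (c :: γ)) = (if j = ((c : ℕ) : ℤ) then pairing Z (M γ) else 0) +
      if j = 0 then pairing Z (M (c :: γ)) else 0 := by
  have hc := c.pos
  rcases H_cases j with h | rfl | ⟨a, rfl⟩
  · rw [H_of_neg h, if_neg h.ne, if_neg (by omega)]; simp
  · rw [H_zero, one_mul, if_pos rfl, if_neg (by omega), zero_add]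
  · have ha := a.pos
    rw [H_coe, pairing_ι_mul_cons, if_neg (c := ((a : ℕ) : ℤ) = 0) (by omega), add_zero]
    simp

/-! ### Products with quasi-symmetric functions -/

theorem consM_M (a : ℕ+) (α : List ℕ+) : consM a (M α) = M (a :: α) := by
  simp [consM, M, Module.Basis.constr_basis]

theorem M_nil_mul (F : QSym) : M [] * F = F := by
  have : mulQ (M []) = LinearMap.id := by
    apply basisM.ext
    intro β
    change M [] * M β = M β
    rw [M_mul_M, quasiShuffle]
  exact LinearMap.congr_fun this F

theorem mul_M_nil (F : QSym) : F * M [] = F := by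
  have : mulQ.flip (M []) = LinearMap.id := by
    apply basisM.ext
    intro β
    change M β * M [] = M β
    rw [M_mul_M]
    cases β <;> rw [quasiShuffle]
  exact LinearMap.congr_fun this F

/-- The quasi-shuffle rule for a product whose left factor starts with `b`. -/
theorem consM_mul_M_cons (b c : ℕ+) (F : QSym) (γ : List ℕ+) :
    consM b F * M (c :: γ) = consM b (F * M (c :: γ)) + consM c (consM b F * M γ)
      + consM (b + c) (F * M γ) := by
  have : mulQ.flip (M (c :: γ)) ∘ₗ consM b = consM b ∘ₗ mulQ.flip (M (c :: γ))
      + consM c ∘ₗ mulQ.flip (M γ) ∘ₗ consM b + consM (b + c) ∘ₗ mulQ.flip (M γ) := by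
    apply basisM.ext
    intro β
    change consM b (M β) * M (c :: γ) = consM b (M β * M (c :: γ)) + consM c (consM b (M β) * M γ)
      + consM (b + c) (M β * M γ)
    rw [consM_M, M_mul_M, M_mul_M, M_mul_M, M_mul_M, quasiShuffle]
  exact LinearMap.congr_fun this F

theorem sum_mulQ {ι : Type*} (t : Finset ι) (F : ι → QSym) (K : QSym) :
    (∑ i ∈ t, F i) * K = ∑ i ∈ t, F i * K := by
  simp [mul_def, map_sum, LinearMap.sum_apply]

/-- The sum of all monomial quasi-symmetric functions of degree `n`. -/
noncomputable def sumM (n : ℕ) : QSym := ∑ β ∈ compositions n, M β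

theorem sumM_zero : sumM 0 = M [] := by simp [sumM, compositions]

/-- Compositions are grouped by their first part i + 1; this exposes the leading letter on which the
quasi-shuffle rule acts. -/
theorem sumM_succ (n : ℕ) :
    sumM (n + 1) = ∑ i ∈ Finset.range (n + 1), consM (Nat.succPNat i) (sumM (n - i)) := by
  rw [sumM, compositions, Finset.sum_biUnion, ← Fin.sum_univ_eq_sum_range
    (fun i => consM (Nat.succPNat i) (sumM (n - i)))]
  · refine Finset.sum_congr rfl fun i _ => ?_
    rw [Finset.sum_image (by simp), sumM, map_sum]
    simp only [consM_M]
  · intro i _ j _ hij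
    rw [Function.onFun, Finset.disjoint_left]
    intro x hx hx'
    simp only [Finset.mem_image] at hx hx'
    obtain ⟨u, -, rfl⟩ := hx
    obtain ⟨v, -, hv⟩ := hx'
    simp only [List.cons.injEq, Nat.succPNat_inj] at hv
    exact hij (Fin.ext hv.1.symm)

theorem size_replicate_one (i : ℕ) : size (List.replicate i 1) = i := by
  induction i with
  | zero => rfl
  | succ i ih => rw [List.replicate_succ, size_cons, ih, PNat.one_coe, add_comm]

theorem eq_replicate_of_size_le (β : List ℕ+) (h : size β ≤ β.length) :
    β = List.replicate β.length 1 ∧ size β = β.length := by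
  have hle : ∀ γ : List ℕ+, γ.length ≤ size γ := by
    intro γ
    induction γ with
    | nil => simp
    | cons c γ ih => have := c.pos; simp only [List.length_cons, size_cons]; omega
  induction β with
  | nil => simp
  | cons b β ih =>
    have hb := b.pos
    have := hle β
    simp only [List.length_cons, size_cons] at h ⊢
    have h1 : b = 1 := PNat.coe_injective (by simp only [PNat.one_coe]; omega)
    obtain ⟨h2, h3⟩ := ih (by omega)
    refine ⟨?_, by omega⟩
    rw [List.replicate_succ, ← h2, h1]

/-- The descent set of 1^i has i - 1 elements, so a refinement of size i needs at least i parts,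
which leaves only 1^i itself. -/
theorem fundamental_replicate_one (i : ℕ) :
    fundamental (List.replicate i 1) = M (List.replicate i 1) := by
  rw [fundamental, size_replicate_one]
  have : (compositions i).filter (fun β => descentSet (List.replicate i 1) ⊆ descentSet β)
      = {List.replicate i 1} := by
    ext β
    rw [Finset.mem_filter, mem_compositions, Finset.mem_singleton]
    constructor
    · rintro ⟨h1, h2⟩
      have hcard : (descentSet (List.replicate i 1)).card = i - 1 := by
        rw [descentSet, Finset.card_image_of_injOn]
        · simp
        · intro x hx y hy hxy
          simp only [List.length_replicate, Finset.coe_Ico, Set.mem_Ico] at hx hy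
          simp only [List.take_replicate, size_replicate_one] at hxy
          omega
      have hc2 : (descentSet β).card ≤ β.length - 1 := by
        refine Finset.card_image_le.trans ?_
        simp
      have hc3 := Finset.card_le_card h2
      -- The cardinalities are truncated differences, so the empty composition (where i = 0) is
      -- treated apart.
      have hlen : i ≤ β.length := by
        cases β with
        | nil => simp at h1; omega
        | cons b β => simp only [List.length_cons] at *; omega
      obtain ⟨h3, h4⟩ := eq_replicate_of_size_le β (by omega)
      rw [h3, ← h4, h1]
    · rintro rfl
      exact ⟨size_replicate_one i, subset_rfl⟩
  rw [this, Finset.sum_singleton]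

theorem fundamental_singleton (s : ℕ+) : fundamental [s] = sumM s := by
  rw [fundamental, sumM]
  have : size [s] = s := by simp
  rw [this, Finset.filter_true_of_mem]
  intro β _
  simp [descentSet]

/-! ### The operators `F_n^⊥` and `F_{1^i}^⊥` -/

/-- The operator `F_n^⊥`, with `F_0 = 1`. -/
noncomputable def perpRow (n : ℕ) : NSym →ₗ[ℚ] NSym := perp (sumM n)

/-- The operator `F_{1^i}^⊥`. -/
noncomputable def perpCol (i : ℕ) : NSym →ₗ[ℚ] NSym := perp (M (List.replicate i 1))

theorem perp_M_nil (X : NSym) : perp (M []) X = X :=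
  ext_pairing fun γ => by rw [pairing_perp, M_nil_mul]

theorem perpRow_zero (X : NSym) : perpRow 0 X = X := by
  rw [perpRow, sumM_zero, perp_M_nil]

theorem perpCol_zero (X : NSym) : perpCol 0 X = X := perp_M_nil X

theorem pairing_one (G : QSym) (b : ℕ+) : pairing 1 (consM b G) = 0 :=
  pairing_consM_nil b G

/-- Every term of a quasi-shuffle with a nonempty factor is nonempty, hence orthogonal to 1. -/
theorem pairing_one_consM_mul (b : ℕ+) (G : QSym) (γ : List ℕ+) :
    pairing 1 (consM b G * M γ) = 0 := by
  cases γ with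
  | nil => rw [mul_M_nil, pairing_one]
  | cons c γ => rw [consM_mul_M_cons]; simp only [map_add, pairing_one, add_zero]

theorem perp_consM_one (b : ℕ+) (G : QSym) : perp (consM b G) 1 = 0 :=
  ext_pairing fun γ => by rw [pairing_perp, pairing_one_consM_mul]; simp

theorem perpRow_succ_one (n : ℕ) : perpRow (n + 1) 1 = 0 := by
  refine ext_pairing fun γ => ?_
  rw [perpRow, pairing_perp, sumM_succ, sum_mulQ, map_sum]
  simp [pairing_one_consM_mul]

theorem perpCol_succ_one (i : ℕ) : perpCol (i + 1) 1 = 0 := by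
  rw [perpCol, List.replicate_succ, ← consM_M, perp_consM_one]

theorem pairing_ι_mul_consM (a b : ℕ+) (Y : NSym) (G : QSym) :
    pairing (FreeAlgebra.ι ℚ a * Y) (consM b G) = if a = b then pairing Y G else 0 := by
  have : (pairing.flip (consM b G)) ∘ₗ LinearMap.mulLeft ℚ (FreeAlgebra.ι ℚ a)
      = if a = b then pairing.flip G else 0 := by
    apply linearMap_ext
    intro α
    rw [LinearMap.comp_apply, LinearMap.mulLeft_apply, LinearMap.flip_apply, ← completeH_cons,
      pairing_consM_cons]
    split_ifs <;> rfl
  have h2 := LinearMap.congr_fun this Y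
  split_ifs at h2 ⊢ with h <;> simpa using h2

/-- `⟨H_a Y, M_{[b, …]} G⟩` for a left factor starting with `b`. -/
theorem pairing_ι_mul_consM_mul (a b c : ℕ+) (Y : NSym) (F : QSym) (γ : List ℕ+) :
    pairing (FreeAlgebra.ι ℚ a * Y) (consM b F * M (c :: γ)) =
      (if a = b then pairing Y (F * M (c :: γ)) else 0)
      + (if a = c then pairing Y (consM b F * M γ) else 0)
      + (if a = b + c then pairing Y (F * M γ) else 0) := by
  rw [consM_mul_M_cons]
  simp only [map_add, pairing_ι_mul_consM]

/-- The first letter a of the word is matched in the quasi-shuffle with 1, with c, or with 1 + c.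
The middle case gives the first term; the outer two together are multiplication by H_{a-1}, which
equals 1 when a = 1. -/
theorem perpCol_succ_ι_mul (i : ℕ) (a : ℕ+) (Y : NSym) :
    perpCol (i + 1) (FreeAlgebra.ι ℚ a * Y)
      = FreeAlgebra.ι ℚ a * perpCol (i + 1) Y + H ((a : ℕ) - 1) * perpCol i Y := by
  have ha := a.pos
  refine ext_pairing fun γ => ?_
  rw [map_add, LinearMap.add_apply]
  simp only [perpCol]
  rw [pairing_perp, List.replicate_succ, ← consM_M]
  cases γ with
  | nil =>
    rw [mul_M_nil, pairing_ι_mul_nil, pairing_H_mul_nil, pairing_ι_mul_consM, pairing_perp,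
      mul_M_nil, zero_add]
    refine if_congr ?_ rfl rfl
    rw [← PNat.coe_inj, PNat.one_coe]
    omega
  | cons c γ =>
    rw [pairing_ι_mul_consM_mul, pairing_ι_mul_cons, pairing_H_mul_cons, pairing_perp,
      pairing_perp, pairing_perp]
    have e1 : (a = 1) ↔ (((a : ℕ) : ℤ) - 1 = 0) := by
      rw [← PNat.coe_inj, PNat.one_coe]; omega
    have e2 : (a = 1 + c) ↔ (((a : ℕ) : ℤ) - 1 = (c : ℕ)) := by
      rw [← PNat.coe_inj, PNat.add_coe, PNat.one_coe]; omega
    simp only [e1, e2]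
    ring

theorem perpRow_ι_mul (n : ℕ) (a : ℕ+) (Y : NSym) :
    perpRow n (FreeAlgebra.ι ℚ a * Y)
      = ∑ k ∈ Finset.range (n + 1), H ((a : ℕ) - k) * perpRow (n - k) Y := by
  have ha := a.pos
  cases n with
  | zero => simp [perpRow_zero, H_coe]
  | succ n =>
    -- The k = 0 term matches a with the head of γ; the term k + 1 collects the compositions in
    -- `sumM` with first part k + 1.
    rw [Finset.sum_range_succ']
    refine ext_pairing fun γ => ?_
    rw [map_add, LinearMap.add_apply, map_sum, LinearMap.sum_apply]
    simp only [Nat.cast_zero, sub_zero, H_coe]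
    simp only [perpRow]
    rw [pairing_perp, sumM_succ, sum_mulQ, map_sum]
    cases γ with
    | nil =>
      rw [pairing_ι_mul_nil, add_zero]
      refine Finset.sum_congr rfl fun k _ => ?_
      rw [mul_M_nil, pairing_ι_mul_consM, pairing_H_mul_nil, pairing_perp, mul_M_nil,
        Nat.add_sub_add_right]
      refine if_congr ?_ rfl rfl
      rw [← PNat.coe_inj, Nat.succPNat_coe]
      omega
    | cons c γ =>
      simp only [pairing_ι_mul_consM_mul, pairing_ι_mul_cons, pairing_H_mul_cons, pairing_perp,
        Nat.add_sub_add_right, Finset.sum_add_distrib]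
      have e1 : ∀ k : ℕ, (a = Nat.succPNat k) ↔ (((a : ℕ) : ℤ) - ((k + 1 : ℕ) : ℤ) = 0) := by
        intro k
        rw [← PNat.coe_inj, Nat.succPNat_coe]; omega
      have e2 : ∀ k : ℕ, (a = Nat.succPNat k + c) ↔
          (((a : ℕ) : ℤ) - ((k + 1 : ℕ) : ℤ) = (c : ℕ)) := by
        intro k
        rw [← PNat.coe_inj, PNat.add_coe, Nat.succPNat_coe]; omega
      have e3 : (if a = c then pairing Y (sumM (n + 1) * M γ) else 0) =
          ∑ k ∈ Finset.range (n + 1),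
            if a = c then pairing Y (consM (Nat.succPNat k) (sumM (n - k)) * M γ) else 0 := by
        split_ifs
        · rw [sumM_succ, sum_mulQ, map_sum]
        · simp
      simp only [Nat.sub_zero, e1, e2, e3]
      ring

theorem perpRow_H_mul (n : ℕ) (a : ℤ) (Y : NSym) :
    perpRow n (H a * Y) = ∑ k ∈ Finset.range (n + 1), H (a - k) * perpRow (n - k) Y := by
  rcases H_cases a with h | rfl | ⟨a, rfl⟩
  · rw [H_of_neg h, zero_mul, map_zero, Finset.sum_eq_zero]
    intro k _
    rw [H_of_neg (by omega), zero_mul]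
  · rw [Finset.sum_range_succ', Finset.sum_eq_zero]
    · simp [H_zero]
    · intro k _
      rw [H_of_neg (by omega), zero_mul]
  · rw [H_coe, perpRow_ι_mul]

/-- All terms with k ≥ 1 in the Leibniz rule reassemble into one application of the rule to H_{a-1}.
This two-term form makes the antipode relation cancel. -/
theorem perpRow_succ_H_mul (n : ℕ) (a : ℤ) (Y : NSym) :
    perpRow (n + 1) (H a * Y) = H a * perpRow (n + 1) Y + perpRow n (H (a - 1) * Y) := by
  rw [perpRow_H_mul, perpRow_H_mul, Finset.sum_range_succ', add_comm]
  simp only [Nat.cast_zero, sub_zero, Nat.sub_zero, Nat.add_sub_add_right, Nat.cast_add,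
    Nat.cast_one, sub_sub, add_comm]

theorem perpCol_succ_H_mul (i : ℕ) (a : ℤ) (Y : NSym) :
    perpCol (i + 1) (H a * Y) = H a * perpCol (i + 1) Y + H (a - 1) * perpCol i Y := by
  rcases H_cases a with h | rfl | ⟨a, rfl⟩
  · rw [H_of_neg h, H_of_neg (by omega)]; simp
  · rw [H_zero, H_of_neg (by omega)]; simp
  · rw [H_coe, perpCol_succ_ι_mul]

/-- Instead of commutativity of the quasi-shuffle product, the proof applies both Leibniz rules
along a word; either order gives the same double sum. -/
theorem perpRow_perpCol_comm (n i : ℕ) (X : NSym) :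
    perpRow n (perpCol i X) = perpCol i (perpRow n X) := by
  suffices h : ∀ α n i, perpRow n (perpCol i (completeH α)) = perpCol i (perpRow n (completeH α)) by
    have : perpRow n ∘ₗ perpCol i = perpCol i ∘ₗ perpRow n := linearMap_ext fun α => h α n i
    exact LinearMap.congr_fun this X
  intro α
  induction α with
  | nil =>
    intro n i
    rw [completeH_nil]
    cases n <;> cases i <;> simp [perpRow_zero, perpCol_zero, perpRow_succ_one, perpCol_succ_one]
  | cons a α ih =>
    intro n i
    cases i with
    | zero => simp only [perpCol_zero]
    | succ i =>
      rw [completeH_cons, ← H_coe, perpCol_succ_H_mul, map_add, perpRow_H_mul, perpRow_H_mul,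
        perpRow_H_mul, map_sum, ← Finset.sum_add_distrib]
      refine Finset.sum_congr rfl fun k _ => ?_
      rw [perpCol_succ_H_mul, ih, ih]
      congr 3
      ring

/-- The antipode relation `∑_{i + n = N} (-1)^i F_n F_{1^i} = 0` for `N > 0`. -/
theorem sum_antidiagonal_perpRow_perpCol (N : ℕ) (X : NSym) :
    ∑ p ∈ Finset.HasAntidiagonal.antidiagonal (N + 1), (-1 : ℚ) ^ p.1 • perpRow p.2 (perpCol p.1 X) = 0 := by
  suffices h : ∀ α, ∑ p ∈ Finset.HasAntidiagonal.antidiagonal (N + 1),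
      (-1 : ℚ) ^ p.1 • perpRow p.2 (perpCol p.1 (completeH α)) = 0 by
    have : ∑ p ∈ Finset.HasAntidiagonal.antidiagonal (N + 1), (-1 : ℚ) ^ p.1 • (perpRow p.2 ∘ₗ perpCol p.1) = 0 :=
      linearMap_ext fun α => by simpa [LinearMap.sum_apply] using h α
    simpa [LinearMap.sum_apply] using LinearMap.congr_fun this X
  intro α
  induction α with
  | nil =>
    rw [completeH_nil]
    refine Finset.sum_eq_zero fun p hp => ?_
    rw [Finset.HasAntidiagonal.mem_antidiagonal] at hp
    obtain ⟨i, n⟩ := p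
    cases i with
    | succ i => simp [perpCol_succ_one]
    | zero =>
      simp only [zero_add] at hp
      subst hp
      simp [perpCol_zero, perpRow_succ_one]
  | cons a α ih =>
    set Y := completeH α with hY
    rw [completeH_cons, ← H_coe, ← hY]
    generalize ((a : ℕ) : ℤ) = j
    -- Moving `perpCol` past H_j here and `perpRow` in `e2` produces the same correction sum over
    -- the antidiagonal of N, with opposite signs.
    have e1 : ∑ p ∈ Finset.HasAntidiagonal.antidiagonal (N + 1),
          (-1 : ℚ) ^ p.1 • perpRow p.2 (perpCol p.1 (H j * Y))
        = ∑ p ∈ Finset.HasAntidiagonal.antidiagonal (N + 1), (-1 : ℚ) ^ p.1 • perpRow p.2 (H j * perpCol p.1 Y)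
          - ∑ p ∈ Finset.HasAntidiagonal.antidiagonal N,
            (-1 : ℚ) ^ p.1 • perpRow p.2 (H (j - 1) * perpCol p.1 Y) := by
      rw [Finset.Nat.sum_antidiagonal_succ, Finset.Nat.sum_antidiagonal_succ]
      simp only [perpCol_zero, perpCol_succ_H_mul, map_add, smul_add, Finset.sum_add_distrib,
        pow_succ, mul_neg, mul_one, neg_smul, Finset.sum_neg_distrib]
      abel
    have e2 : ∑ p ∈ Finset.HasAntidiagonal.antidiagonal (N + 1), (-1 : ℚ) ^ p.1 • perpRow p.2 (H j * perpCol p.1 Y)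
        = H j * ∑ p ∈ Finset.HasAntidiagonal.antidiagonal (N + 1), (-1 : ℚ) ^ p.1 • perpRow p.2 (perpCol p.1 Y)
          + ∑ p ∈ Finset.HasAntidiagonal.antidiagonal N,
            (-1 : ℚ) ^ p.1 • perpRow p.2 (H (j - 1) * perpCol p.1 Y) := by
      rw [Finset.Nat.sum_antidiagonal_succ', Finset.Nat.sum_antidiagonal_succ']
      simp only [perpRow_zero, perpRow_succ_H_mul, smul_add, Finset.sum_add_distrib, mul_add,
        Finset.mul_sum, mul_smul_comm]
      abel
    rw [e1, e2, ih, mul_zero, zero_add, sub_self]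

/-! ### Bernstein operators -/

theorem exists_perpCol_eq_zero (X : NSym) : ∃ N, ∀ i, N ≤ i → perpCol i X = 0 := by
  refine ⟨(basisH.repr X).support.sup size + 1, fun i hi => ?_⟩
  rw [← basisH.linearCombination_repr X, Finsupp.linearCombination_apply, Finsupp.sum, map_sum]
  refine Finset.sum_eq_zero fun β hβ => ?_
  have hle : size β ≤ (basisH.repr X).support.sup size := Finset.le_sup hβ
  rw [map_smul, basisH_apply, perpCol, ← fundamental_replicate_one,
    perp_fundamental_eq_zero _ _ (by rw [size_replicate_one]; omega), smul_zero]

theorem bernstein_eq_sum (m : ℤ) (X : NSym) {N : ℕ} (hN : ∀ i, N ≤ i → perpCol i X = 0) :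
    bernstein m X = ∑ i ∈ Finset.range N, (-1 : ℚ) ^ i • (H (m + i) * perpCol i X) := by
  rw [bernstein]
  simp only [fundamental_replicate_one]
  change ∑ᶠ i : ℕ, (-1 : ℚ) ^ i • (H (m + i) * perpCol i X) = _
  refine finsum_eq_sum_of_support_subset _ fun i hi => ?_
  rw [Finset.mem_coe, Finset.mem_range]
  by_contra hlt
  exact hi (by simp [hN i (by omega)])

theorem bernstein_sum {ι : Type*} (m : ℤ) (t : Finset ι) (X : ι → NSym) :
    bernstein m (∑ j ∈ t, X j) = ∑ j ∈ t, bernstein m (X j) := by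
  choose N hN using fun j => exists_perpCol_eq_zero (X j)
  have h1 : ∀ j ∈ t, ∀ i, t.sup N ≤ i → perpCol i (X j) = 0 := fun j hj i hi =>
    hN j i ((Finset.le_sup hj).trans hi)
  rw [bernstein_eq_sum m _ (N := t.sup N), Finset.sum_congr rfl
    fun j hj => bernstein_eq_sum m _ (h1 j hj), Finset.sum_comm]
  · simp only [map_sum, Finset.mul_sum, Finset.smul_sum]
  · intro i hi
    rw [map_sum]
    exact Finset.sum_eq_zero fun j hj => h1 j hj i hi

theorem bernstein_zero (m : ℤ) : bernstein m 0 = 0 := by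
  simpa using bernstein_sum m (∅ : Finset ℕ) (fun _ => 0)

/-- The Leibniz rule lowers H_{a+i} to H_{(a-k)+i}, and the remaining `perpRow` commutes with
`perpCol`; one truncation bound N serves all terms. -/
theorem perpRow_bernstein (s : ℕ) (a : ℤ) (X : NSym) :
    perpRow s (bernstein a X)
      = ∑ k ∈ Finset.range (s + 1), bernstein (a - k) (perpRow (s - k) X) := by
  obtain ⟨N, hN⟩ := exists_perpCol_eq_zero X
  have h1 : ∀ k i, N ≤ i → perpCol i (perpRow k X) = 0 := by
    intro k i hi
    rw [← perpRow_perpCol_comm, hN i hi, map_zero]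
  rw [bernstein_eq_sum a X hN, map_sum, Finset.sum_congr rfl
    fun (k : ℕ) _ => bernstein_eq_sum (a - k) _ (h1 (s - k)), Finset.sum_comm]
  refine Finset.sum_congr rfl fun i _ => ?_
  rw [map_smul, perpRow_H_mul, Finset.smul_sum]
  refine Finset.sum_congr rfl fun k _ => ?_
  rw [perpRow_perpCol_comm]
  congr 3
  ring

theorem sum_range_prod_eq_sum_antidiagonal {A : Type*} [AddCommMonoid A] (L : ℕ) (f : ℕ × ℕ → A)
    (hf : ∀ p : ℕ × ℕ, L ≤ p.1 ∨ L ≤ p.2 → f p = 0) :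
    ∑ p ∈ Finset.range L ×ˢ Finset.range L, f p
      = ∑ N ∈ Finset.range (2 * L + 1), ∑ p ∈ Finset.HasAntidiagonal.antidiagonal N, f p := by
  rw [← Finset.sum_fiberwise_of_maps_to (t := Finset.range (2 * L + 1)) (g := fun p => p.1 + p.2)]
  · refine Finset.sum_congr rfl fun N _ => Finset.sum_subset ?_ ?_
    · intro p hp
      rw [Finset.mem_filter] at hp
      exact Finset.HasAntidiagonal.mem_antidiagonal.2 hp.2
    · intro p hp hp'
      rw [Finset.HasAntidiagonal.mem_antidiagonal] at hp
      apply hf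
      by_contra hcon
      apply hp'
      simp only [Finset.mem_filter, Finset.mem_product, Finset.mem_range]
      omega
  · intro p hp
    simp only [Finset.mem_product, Finset.mem_range] at hp ⊢
    omega

/-- The index of H in the expanded double sum depends only on i + n, so each antidiagonal factors
out an antipode sum, and only i + n = 0 survives. -/
theorem sum_bernstein_perpRow (s : ℕ) (t : ℤ) (X : NSym) (hX : ∀ n, s < n → perpRow n X = 0) :
    ∑ n ∈ Finset.range (s + 1), bernstein (t + n) (perpRow n X) = H t * X := by
  obtain ⟨N, hN⟩ := exists_perpCol_eq_zero X
  set L := max N (s + 1) with hL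
  have h1 : ∀ k i, L ≤ i → perpCol i (perpRow k X) = 0 := by
    intro k i hi
    rw [← perpRow_perpCol_comm, hN i (by omega), map_zero]
  rw [Finset.sum_subset (s₂ := Finset.range L) (by
      intro x hx; simp only [Finset.mem_range] at *; omega) (by
      intro n _ hn
      rw [Finset.mem_range] at hn
      rw [hX n (by omega), bernstein_zero]), Finset.sum_congr rfl
    fun (n : ℕ) _ => bernstein_eq_sum (t + n) _ (h1 n), Finset.sum_comm]
  rw [← Finset.sum_product' (f := fun i n : ℕ =>
      (-1 : ℚ) ^ i • (H (t + n + i) * perpCol i (perpRow n X))),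
    sum_range_prod_eq_sum_antidiagonal L]
  · have key : ∀ M : ℕ, ∑ p ∈ Finset.HasAntidiagonal.antidiagonal M,
        (-1 : ℚ) ^ p.1 • (H (t + p.2 + p.1) * perpCol p.1 (perpRow p.2 X))
        = H (t + M) * ∑ p ∈ Finset.HasAntidiagonal.antidiagonal M, (-1 : ℚ) ^ p.1 • perpRow p.2 (perpCol p.1 X) := by
      intro M
      rw [Finset.mul_sum]
      refine Finset.sum_congr rfl fun p hp => ?_
      rw [Finset.HasAntidiagonal.mem_antidiagonal] at hp
      rw [mul_smul_comm, perpRow_perpCol_comm]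
      congr 3
      omega
    rw [Finset.sum_congr rfl fun M _ => key M, Finset.sum_range_succ', Finset.sum_eq_zero]
    · simp [perpRow_zero, perpCol_zero]
    · intro M _
      rw [sum_antidiagonal_perpRow_perpCol, mul_zero]
  · rintro ⟨i, n⟩ (h | h)
    · simp only at h
      simp only [h1 n i h, mul_zero, smul_zero]
    · simp only at h
      simp only [hX n (by omega), map_zero, mul_zero, smul_zero]

theorem toInts_nil : toInts [] = [] := rfl

theorem toInts_cons (a : ℕ+) (α : List ℕ+) : toInts (a :: α) = ((a : ℕ) : ℤ) :: toInts α := rfl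

theorem immaculate_nil : immaculate [] = 1 := rfl

theorem immaculate_cons (m : ℤ) (α : List ℤ) :
    immaculate (m :: α) = bernstein m (immaculate α) := rfl

theorem toInts_injective : Function.Injective toInts := by
  intro α β h
  induction α generalizing β with
  | nil => cases β with
    | nil => rfl
    | cons b β => simp [toInts] at h
  | cons a α ih => cases β with
    | nil => simp [toInts] at h
    | cons b β =>
      obtain ⟨h1, h2⟩ := List.cons.inj h
      rw [ih h2, PNat.coe_injective (Int.natCast_inj.1 h1)]

/-! ### The Pieri rule for partitions -/

/-- Reversing the summation k ↦ s - k turns the commutation formula into the inversion formula with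
t = a - s. -/
theorem perpRow_bernstein_of_vanish (s : ℕ) (a : ℤ) (X : NSym)
    (hX : ∀ n, s < n → perpRow n X = 0) : perpRow s (bernstein a X) = H (a - s) * X := by
  rw [perpRow_bernstein, ← sum_bernstein_perpRow s (a - s) X hX, ← Finset.sum_range_reflect]
  refine Finset.sum_congr rfl fun k hk => ?_
  rw [Finset.mem_range] at hk
  have e1 : s - (s + 1 - 1 - k) = k := by omega
  have e2 : a - ((s + 1 - 1 - k : ℕ) : ℤ) = a - s + k := by omega
  rw [e1, e2]

theorem perpRow_immaculate_of_lt (α : List ℕ+) (hα : IsPartition α) :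
    ∀ n : ℕ, 0 < n → (∀ b ∈ α, (b : ℕ) < n) → perpRow n (immaculate (toInts α)) = 0 := by
  induction α with
  | nil =>
    intro n hn _
    obtain ⟨n, rfl⟩ := Nat.exists_eq_succ_of_ne_zero hn.ne'
    exact perpRow_succ_one n
  | cons a α ih =>
    intro n hn h
    obtain ⟨-, hα'⟩ := List.pairwise_cons.1 hα
    have ha := h a (by simp)
    rw [toInts_cons, immaculate_cons, perpRow_bernstein_of_vanish, H_of_neg (by omega), zero_mul]
    intro k hk
    exact ih hα' k (by omega) fun b hb => (h b (by simp [hb])).trans hk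

theorem perpRow_immaculate_cons_self (a : ℕ+) (α : List ℕ+) (hα : IsPartition (a :: α)) :
    perpRow a (immaculate (toInts (a :: α))) = immaculate (toInts α) := by
  obtain ⟨h1, h2⟩ := List.pairwise_cons.1 hα
  rw [toInts_cons, immaculate_cons, perpRow_bernstein_of_vanish, sub_self, H_zero, one_mul]
  intro n hn
  exact perpRow_immaculate_of_lt α h2 n (by omega) fun b hb => lt_of_le_of_lt (h1 b hb) hn

/-- The compositions occurring in the expansion of `F_s^⊥ 𝔖_α`, for a partition `α`. -/
def pieriSet : ℕ → List ℕ+ → Finset (List ℕ+)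
  | s, [] => if s = 0 then {[]} else ∅
  | s, a :: α =>
    if (a : ℕ) < s then ∅ else if (a : ℕ) = s then {α} else
      (Finset.range (s + 1)).biUnion fun k =>
        (pieriSet (s - k) α).image fun γ => Nat.toPNat' (a - k) :: γ

theorem mem_pieriSet_cons_of_lt {s : ℕ} {a : ℕ+} {α : List ℕ+} (h : s < a) (γ : List ℕ+) :
    γ ∈ pieriSet s (a :: α) ↔ ∃ k ≤ s, ∃ g : ℕ+, ∃ γ' ∈ pieriSet (s - k) α,
      γ = g :: γ' ∧ (g : ℕ) + k = a := by
  rw [pieriSet, if_neg (by omega), if_neg (by omega)]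
  simp only [Finset.mem_biUnion, Finset.mem_range, Finset.mem_image]
  constructor
  · rintro ⟨k, hk, γ', h1, rfl⟩
    refine ⟨k, by omega, _, γ', h1, rfl, ?_⟩
    rw [Nat.toPNat'_coe, if_pos (by omega)]
    omega
  · rintro ⟨k, hk, g, γ', h1, rfl, h2⟩
    refine ⟨k, by omega, γ', h1, ?_⟩
    congr 1
    apply PNat.coe_injective
    rw [Nat.toPNat'_coe, if_pos (by omega)]
    omega

theorem size_of_mem_pieriSet (α : List ℕ+) :
    ∀ s : ℕ, ∀ γ ∈ pieriSet s α, size γ + s = size α := by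
  induction α with
  | nil =>
    intro s γ h
    rw [pieriSet] at h
    split_ifs at h with hs
    · rw [Finset.mem_singleton] at h
      simp [h, hs]
    · simp at h
  | cons a α ih =>
    intro s γ h
    rcases lt_trichotomy (a : ℕ) s with h1 | h1 | h1
    · simp [pieriSet, h1] at h
    · rw [pieriSet, if_neg (by omega), if_pos h1, Finset.mem_singleton] at h
      rw [h, size_cons, ← h1, add_comm]
    · rw [mem_pieriSet_cons_of_lt h1] at h
      obtain ⟨k, hk, g, γ', h2, rfl, h3⟩ := h
      have := ih _ _ h2
      rw [size_cons, size_cons]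
      omega

theorem perpRow_immaculate (α : List ℕ+) (hα : IsPartition α) :
    ∀ s : ℕ, perpRow s (immaculate (toInts α)) = ∑ γ ∈ pieriSet s α, immaculate (toInts γ) := by
  induction α with
  | nil =>
    intro s
    rw [pieriSet, toInts_nil, immaculate_nil]
    cases s with
    | zero => simp [perpRow_zero, toInts_nil, immaculate_nil]
    | succ s => simp [perpRow_succ_one]
  | cons a α ih =>
    intro s
    obtain ⟨h1, h2⟩ := List.pairwise_cons.1 hα
    rcases lt_trichotomy (a : ℕ) s with h | h | h
    · rw [pieriSet, if_pos h, Finset.sum_empty]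
      refine perpRow_immaculate_of_lt _ hα s (by omega) fun b hb => ?_
      rcases List.mem_cons.1 hb with rfl | hb
      · exact h
      · exact lt_of_le_of_lt (h1 b hb) h
    · rw [pieriSet, if_neg (by omega), if_pos h, Finset.sum_singleton, ← h,
        perpRow_immaculate_cons_self a α hα]
    · rw [pieriSet, if_neg (by omega), if_neg (by omega), Finset.sum_biUnion, toInts_cons,
        immaculate_cons, perpRow_bernstein]
      · refine Finset.sum_congr rfl fun k hk => ?_
        rw [Finset.mem_range] at hk
        rw [Finset.sum_image (by simp), ih h2, bernstein_sum]
        refine Finset.sum_congr rfl fun γ _ => ?_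
        rw [toInts_cons, immaculate_cons, Nat.toPNat'_coe, if_pos (by omega)]
        congr 1
        omega
      -- The images are disjoint because the heads a - k, for k ≤ s < a, are distinct; no truncation
      -- occurs.
      · intro i hi j hj hij
        rw [Finset.mem_coe, Finset.mem_range] at hi hj
        rw [Function.onFun, Finset.disjoint_left]
        intro x hx hx'
        simp only [Finset.mem_image] at hx hx'
        obtain ⟨u, -, rfl⟩ := hx
        obtain ⟨v, -, hv⟩ := hx'
        have h3 := congrArg PNat.val (List.cons.inj hv).1
        change ((Nat.toPNat' _ : ℕ+) : ℕ) = ((Nat.toPNat' _ : ℕ+) : ℕ) at h3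
        rw [Nat.toPNat'_coe, Nat.toPNat'_coe, if_pos (by omega), if_pos (by omega)] at h3
        omega

/-! ### The coefficients for partitions -/

theorem sum_Iio_succ {n : ℕ} (β : Fin (n + 1) → ℤ) (i : Fin n) :
    ∑ j ∈ Finset.Iio i.succ, β j = β 0 + ∑ j ∈ Finset.Iio i, β j.succ := by
  have h : ∀ (m : ℕ) (f : Fin m → ℤ) (i : Fin m),
      ∑ j ∈ Finset.Iio i, f j = ∑ j, if j < i then f j else 0 := by
    intro m f i
    rw [← Finset.sum_filter]
    congr 1
    ext; simp
  rw [h, h, Fin.sum_univ_succ]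
  simp

theorem sum_Iic_succ {n : ℕ} (β : Fin (n + 1) → ℤ) (i : Fin n) :
    ∑ j ∈ Finset.Iic i.succ, β j = β 0 + ∑ j ∈ Finset.Iic i, β j.succ := by
  have h : ∀ (m : ℕ) (f : Fin m → ℤ) (i : Fin m),
      ∑ j ∈ Finset.Iic i, f j = ∑ j, if j ≤ i then f j else 0 := by
    intro m f i
    rw [← Finset.sum_filter]
    congr 1
    ext; simp
  rw [h, h, Fin.sum_univ_succ]
  simp

theorem sum_Iio_zero {n : ℕ} (β : Fin (n + 1) → ℤ) : ∑ j ∈ Finset.Iio 0, β j = 0 := by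
  have : Finset.Iio (0 : Fin (n + 1)) = ∅ := by ext; simp
  rw [this, Finset.sum_empty]

theorem sum_Iic_zero {n : ℕ} (β : Fin (n + 1) → ℤ) : ∑ j ∈ Finset.Iic 0, β j = β 0 := by
  have : Finset.Iic (0 : Fin (n + 1)) = {0} := by ext; simp
  rw [this, Finset.sum_singleton]

theorem InZ.head_le {s : ℕ} {a : ℕ+} {α : List ℕ+} {β : Fin (α.length + 1) → ℤ}
    (h : InZ s (a :: α) β) : β 0 ≤ s := by
  have h1 : ∑ j ∈ Finset.Iic (0 : Fin (α.length + 1)), β j ≤ s := h.sum_le (0 : Fin (α.length + 1))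
  rwa [sum_Iic_zero] at h1

theorem InZ.head_of_gt {s : ℕ} {a : ℕ+} {α : List ℕ+} {β : Fin (α.length + 1) → ℤ}
    (h : InZ s (a :: α) β) (hs : s < a) : 0 ≤ β 0 := by
  have h1 : (s : ℤ) - ∑ j ∈ Finset.Iio (0 : Fin (α.length + 1)), β j < ((a : ℕ) : ℤ) →
    0 ≤ β 0 ∧ β 0 ≤ s - ∑ j ∈ Finset.Iio (0 : Fin (α.length + 1)), β j :=
    h.of_gt (0 : Fin (α.length + 1))
  rw [sum_Iio_zero, sub_zero] at h1
  exact (h1 (by omega)).1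

theorem InZ.head_of_eq {a : ℕ+} {α : List ℕ+} {β : Fin (α.length + 1) → ℤ}
    (h : InZ a (a :: α) β) :
    (β 0 = ((a : ℕ) : ℤ) ∧ ∀ j : Fin (α.length + 1), 0 < j → β j = 0) ∨ β 0 < 0 := by
  have h1 : ((a : ℕ) : ℤ) = (a : ℕ) - ∑ j ∈ Finset.Iio (0 : Fin (α.length + 1)), β j →
    (β 0 = ((a : ℕ) : ℤ) ∧ ∀ j : Fin (α.length + 1), 0 < j → β j = 0) ∨ β 0 < 0 :=
    h.of_eq (0 : Fin (α.length + 1))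
  rw [sum_Iio_zero, sub_zero] at h1
  exact h1 rfl

theorem InZ.head_of_lt {s : ℕ} {a : ℕ+} {α : List ℕ+} {β : Fin (α.length + 1) → ℤ}
    (h : InZ s (a :: α) β) (hs : a < s) : β 0 < 0 := by
  have h1 : ((a : ℕ) : ℤ) < s - ∑ j ∈ Finset.Iio (0 : Fin (α.length + 1)), β j → β 0 < 0 :=
    h.of_lt (0 : Fin (α.length + 1))
  rw [sum_Iio_zero, sub_zero] at h1
  exact h1 (by omega)

/-- Every condition depends only on the remainder R_i, and replacing s by s - β₁ leaves the later
remainders unchanged. -/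
theorem InZ.tail {s t : ℕ} {a : ℕ+} {α : List ℕ+} {β : Fin (α.length + 1) → ℤ}
    (h : InZ s (a :: α) β) (ht : (t : ℤ) = s - β 0) : InZ t α fun i => β i.succ where
  sum_eq := by
    have h1 : ∑ i : Fin (α.length + 1), β i = s := h.sum_eq
    rw [Fin.sum_univ_succ] at h1
    omega
  sum_le i := by
    have h1 : ∑ j ∈ Finset.Iic i.succ, β j ≤ s := h.sum_le i.succ
    rw [sum_Iic_succ] at h1
    omega
  nonneg i := h.nonneg i.succ
  zero_unique i j hi hj := Fin.succ_injective _ (h.zero_unique i.succ j.succ hi hj)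
  of_gt i := by
    have h1 : (s : ℤ) - ∑ j ∈ Finset.Iio i.succ, β j < ((α.get i : ℕ) : ℤ) →
      0 ≤ β i.succ ∧ β i.succ ≤ s - ∑ j ∈ Finset.Iio i.succ, β j := h.of_gt i.succ
    rwa [sum_Iio_succ, ← sub_sub, ← ht] at h1
  of_eq i := by
    have h1 : ((α.get i : ℕ) : ℤ) = s - ∑ j ∈ Finset.Iio i.succ, β j →
      (β i.succ = ((α.get i : ℕ) : ℤ) ∧ ∀ j : Fin (α.length + 1), i.succ < j → β j = 0)
        ∨ β i.succ < 0 := h.of_eq i.succ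
    rw [sum_Iio_succ, ← sub_sub, ← ht] at h1
    intro h2
    exact (h1 h2).imp_left fun h3 => ⟨h3.1, fun j hj => h3.2 j.succ (Fin.succ_lt_succ_iff.2 hj)⟩
  of_lt i := by
    have h1 : ((α.get i : ℕ) : ℤ) < s - ∑ j ∈ Finset.Iio i.succ, β j → β i.succ < 0 :=
      h.of_lt i.succ
    rwa [sum_Iio_succ, ← sub_sub, ← ht] at h1

theorem InZ.cons {s k : ℕ} {a : ℕ+} {α : List ℕ+} {β : Fin α.length → ℤ} (hs : s < a)
    (hk : k ≤ s) (h : InZ (s - k) α β) :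
    InZ s (a :: α) (Fin.cons (k : ℤ) β : Fin (α.length + 1) → ℤ) := by
  set B : Fin (α.length + 1) → ℤ := Fin.cons (k : ℤ) β with hB
  have ht : ((s - k : ℕ) : ℤ) = s - k := by omega
  have e0 : B 0 = k := rfl
  have eS : ∀ i : Fin α.length, B i.succ = β i := fun _ => rfl
  have g0 : (a :: α).get (0 : Fin (α.length + 1)) = a := rfl
  have gS : ∀ i : Fin α.length, (a :: α).get (Fin.succ i : Fin (α.length + 1)) = α.get i :=
    fun _ => rfl
  have hio : ∀ i : Fin α.length, (s : ℤ) - ∑ j ∈ Finset.Iio i.succ, B j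
      = ((s - k : ℕ) : ℤ) - ∑ j ∈ Finset.Iio i, β j := by
    intro i
    rw [sum_Iio_succ, ht, ← sub_sub, e0]
    rfl
  constructor
  · change ∑ i : Fin (α.length + 1), B i = s
    have := h.sum_eq
    rw [Fin.sum_univ_succ, e0]
    simp only [eS]
    omega
  · change ∀ i : Fin (α.length + 1), ∑ j ∈ Finset.Iic i, B j ≤ s
    refine Fin.cases ?_ fun i => ?_
    · rw [sum_Iic_zero]; omega
    · have := h.sum_le i
      rw [sum_Iic_succ, e0]
      simp only [eS]
      omega
  · change ∀ i : Fin (α.length + 1), 0 ≤ (((a :: α).get i : ℕ) : ℤ) - B i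
    refine Fin.cases ?_ fun i => ?_
    · rw [g0]; omega
    · exact h.nonneg i
  · change ∀ i j : Fin (α.length + 1), (((a :: α).get i : ℕ) : ℤ) - B i = 0 →
      (((a :: α).get j : ℕ) : ℤ) - B j = 0 → i = j
    refine Fin.cases (fun j hj => ?_) fun i => Fin.cases (fun _ hj => ?_) fun j hi hj => ?_
    · rw [g0] at hj; omega
    · rw [g0] at hj; omega
    · exact congrArg Fin.succ (h.zero_unique i j hi hj)
  · change ∀ i : Fin (α.length + 1), (s : ℤ) - ∑ j ∈ Finset.Iio i, B j
      < (((a :: α).get i : ℕ) : ℤ) → 0 ≤ B i ∧ B i ≤ s - ∑ j ∈ Finset.Iio i, B j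
    refine Fin.cases (fun _ => ?_) fun i => ?_
    · rw [sum_Iio_zero]; omega
    · rw [hio]; exact h.of_gt i
  · change ∀ i : Fin (α.length + 1), (((a :: α).get i : ℕ) : ℤ)
      = s - ∑ j ∈ Finset.Iio i, B j → (B i = (((a :: α).get i : ℕ) : ℤ) ∧
        ∀ j : Fin (α.length + 1), i < j → B j = 0) ∨ B i < 0
    refine Fin.cases (fun h1 => ?_) fun i => ?_
    · rw [sum_Iio_zero, g0] at h1; omega
    · rw [hio]
      intro h1
      refine (h.of_eq i h1).imp_left fun h2 => ⟨h2.1, Fin.cases (fun h3 => ?_) fun j hj => ?_⟩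
      · exact absurd h3 (by simp)
      · exact h2.2 j (Fin.succ_lt_succ_iff.1 hj)
  · change ∀ i : Fin (α.length + 1), (((a :: α).get i : ℕ) : ℤ)
      < s - ∑ j ∈ Finset.Iio i, B j → B i < 0
    refine Fin.cases (fun h1 => ?_) fun i => ?_
    · rw [sum_Iio_zero, g0] at h1; omega
    · rw [hio]; exact h.of_lt i

/-- The first entry is forced to be negative, so the remainder grows and still exceeds every later
part. At the end of the list a positive remainder is left with no entries to fill it. -/
theorem not_inZ_of_lt (α : List ℕ+) : ∀ (s : ℕ) (β : Fin α.length → ℤ), 0 < s →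
    (∀ b ∈ α, (b : ℕ) < s) → ¬ InZ s α β := by
  induction α with
  | nil =>
    intro s β hs _ h
    have : ∑ i : Fin 0, β i = s := h.sum_eq
    rw [Fin.sum_univ_zero] at this
    omega
  | cons a α ih =>
    intro s β hs hb h
    have h0 := h.head_of_lt (hb a (by simp))
    obtain ⟨t, ht⟩ : ∃ t : ℕ, (t : ℤ) = s - β (0 : Fin (α.length + 1)) :=
      ⟨(s - β (0 : Fin (α.length + 1))).toNat, by omega⟩
    refine ih t _ (by omega) (fun b hb' => ?_) (h.tail ht)
    have := hb b (by simp [hb'])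
    omega

theorem inZ_cons_self (a : ℕ+) (α : List ℕ+) :
    InZ a (a :: α) (Fin.cons ((a : ℕ) : ℤ) 0 : Fin (α.length + 1) → ℤ) := by
  have ha := a.pos
  set B : Fin (α.length + 1) → ℤ := Fin.cons ((a : ℕ) : ℤ) 0 with hB
  have e0 : B 0 = (a : ℕ) := rfl
  have eS : ∀ i : Fin α.length, B i.succ = 0 := fun _ => rfl
  have g0 : (a :: α).get (0 : Fin (α.length + 1)) = a := rfl
  have hpos : ∀ i : Fin (α.length + 1), (0 : ℤ) < (((a :: α).get i : ℕ) : ℤ) := fun i => by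
    exact_mod_cast ((a :: α).get i).pos
  have hio : ∀ i : Fin α.length, ((a : ℕ) : ℤ) - ∑ j ∈ Finset.Iio i.succ, B j = 0 := by
    intro i
    rw [sum_Iio_succ, e0]
    simp [eS]
  constructor
  · change ∑ i : Fin (α.length + 1), B i = (a : ℕ)
    rw [Fin.sum_univ_succ, e0]
    simp [eS]
  · change ∀ i : Fin (α.length + 1), ∑ j ∈ Finset.Iic i, B j ≤ (a : ℕ)
    refine Fin.cases ?_ fun i => ?_
    · rw [sum_Iic_zero, e0]
    · rw [sum_Iic_succ, e0]
      simp [eS]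
  · change ∀ i : Fin (α.length + 1), 0 ≤ (((a :: α).get i : ℕ) : ℤ) - B i
    refine Fin.cases ?_ fun i => ?_
    · rw [g0]; omega
    · have := hpos i.succ
      rw [eS]; omega
  · change ∀ i j : Fin (α.length + 1), (((a :: α).get i : ℕ) : ℤ) - B i = 0 →
      (((a :: α).get j : ℕ) : ℤ) - B j = 0 → i = j
    have hz : ∀ i : Fin (α.length + 1), (((a :: α).get i : ℕ) : ℤ) - B i = 0 → i = 0 := by
      refine Fin.cases (fun _ => rfl) fun i hi => ?_
      have := hpos i.succ
      rw [eS] at hi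
      omega
    exact fun i j hi hj => (hz i hi).trans (hz j hj).symm
  · change ∀ i : Fin (α.length + 1), ((a : ℕ) : ℤ) - ∑ j ∈ Finset.Iio i, B j
      < (((a :: α).get i : ℕ) : ℤ) → 0 ≤ B i ∧ B i ≤ (a : ℕ) - ∑ j ∈ Finset.Iio i, B j
    refine Fin.cases (fun _ => ?_) fun i _ => ?_
    · rw [sum_Iio_zero]; omega
    -- Once the head has consumed a, every later remainder is 0, below any part, so the only demand
    -- is 0 ≤ 0 ≤ 0.
    · rw [hio, eS]; omega
  · change ∀ i : Fin (α.length + 1), (((a :: α).get i : ℕ) : ℤ)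
      = (a : ℕ) - ∑ j ∈ Finset.Iio i, B j → (B i = (((a :: α).get i : ℕ) : ℤ) ∧
        ∀ j : Fin (α.length + 1), i < j → B j = 0) ∨ B i < 0
    refine Fin.cases (fun h1 => ?_) fun i h1 => ?_
    · exact Or.inl ⟨rfl, Fin.cases (fun h => absurd h (by simp)) fun j _ => eS j⟩
    · have := hpos i.succ
      rw [hio] at h1
      omega
  · change ∀ i : Fin (α.length + 1), (((a :: α).get i : ℕ) : ℤ)
      < (a : ℕ) - ∑ j ∈ Finset.Iio i, B j → B i < 0
    refine Fin.cases (fun h1 => ?_) fun i h1 => ?_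
    · rw [sum_Iio_zero, g0] at h1; omega
    · have := hpos i.succ
      rw [hio] at h1
      omega

/-! ### The fibres Z_{s,α}^γ, one entry at a time -/

theorem compDiff_cons (a : ℕ+) (α : List ℕ+) (β : Fin (α.length + 1) → ℤ) :
    compDiff (a :: α) β = if ((a : ℕ) : ℤ) - β 0 = 0 then compDiff α (fun i => β i.succ)
      else (((a : ℕ) : ℤ) - β 0) :: compDiff α (fun i => β i.succ) := by
  have : List.ofFn (fun i : Fin (α.length + 1) => (((a :: α).get i : ℕ) : ℤ) - β i)
      = (((a : ℕ) : ℤ) - β 0) :: List.ofFn (fun i => ((α.get i : ℕ) : ℤ) - β i.succ) := by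
    rw [List.ofFn_succ]
    rfl
  change (List.ofFn (fun i : Fin (α.length + 1) => (((a :: α).get i : ℕ) : ℤ) - β i)).filter _ = _
  rw [this, List.filter_cons]
  by_cases h : ((a : ℕ) : ℤ) - β 0 = 0
  · simp [h, compDiff]
  · simp [h, compDiff]

theorem compDiff_zero (α : List ℕ+) : compDiff α (fun _ => 0) = toInts α := by
  induction α with
  | nil => rfl
  | cons a α ih =>
    have := compDiff_cons a α (fun _ => 0)
    rw [sub_zero, if_neg (by exact_mod_cast a.ne_zero), ih] at this
    exact this

theorem mem_setZ_of_lt {s : ℕ} {a : ℕ+} {α γ : List ℕ+} (hs : s < a)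
    {β : Fin (α.length + 1) → ℤ} : β ∈ setZ s (a :: α) γ ↔ ∃ k ≤ s, ∃ g : ℕ+, ∃ γ',
      γ = g :: γ' ∧ (g : ℕ) + k = a ∧ β 0 = k ∧ (fun i => β i.succ) ∈ setZ (s - k) α γ' := by
  constructor
  · rintro ⟨h, hγ⟩
    have h0 := h.head_le
    have h1 := h.head_of_gt hs
    obtain ⟨k, hk⟩ := Int.eq_ofNat_of_zero_le h1
    have hks : k ≤ s := by omega
    have hd := compDiff_cons a α β
    rw [if_neg (by omega)] at hd
    cases γ with
    | nil =>
      rw [hγ] at hd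
      exact absurd hd (by simp [toInts_nil])
    | cons g γ' =>
      rw [hγ, toInts_cons, List.cons.injEq] at hd
      exact ⟨k, hks, g, γ', rfl, by omega, hk, h.tail (by omega), hd.2.symm⟩
  · rintro ⟨k, hk, g, γ', rfl, h1, h2, h3, h4⟩
    have hβ : β = Fin.cons (k : ℤ) (fun i => β i.succ) := by
      funext i
      refine Fin.cases ?_ (fun i => ?_) i
      · exact h2
      · rfl
    refine ⟨hβ ▸ h3.cons hs hk, ?_⟩
    have hd := compDiff_cons a α β
    have hg := g.pos
    rw [if_neg (by omega), h4] at hd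
    refine hd.trans ?_
    rw [toInts_cons]
    congr 1
    omega

theorem mem_setZ_self {a : ℕ+} {α γ : List ℕ+} (hα : IsPartition (a :: α))
    {β : Fin (α.length + 1) → ℤ} :
    β ∈ setZ a (a :: α) γ ↔ β = Fin.cons ((a : ℕ) : ℤ) 0 ∧ γ = α := by
  have hcd : compDiff (a :: α) (Fin.cons ((a : ℕ) : ℤ) 0 : Fin (α.length + 1) → ℤ) = toInts α := by
    have hd := compDiff_cons a α (Fin.cons ((a : ℕ) : ℤ) 0)
    rw [Fin.cons_zero, sub_self, if_pos rfl] at hd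
    exact hd.trans (compDiff_zero α)
  constructor
  · rintro ⟨h, hγ⟩
    rcases h.head_of_eq with h1 | h1
    · have hβ : β = Fin.cons ((a : ℕ) : ℤ) 0 := by
        funext i
        refine Fin.cases ?_ (fun i => ?_) i
        · exact h1.1
        · exact h1.2 i.succ (Fin.succ_pos i)
      refine ⟨hβ, ?_⟩
      subst hβ
      exact toInts_injective (hγ.symm.trans hcd)
    · exfalso
      -- A negative first entry makes the new target t exceed a, hence every part of the tail, since
      -- the parts decrease.
      obtain ⟨t, ht⟩ : ∃ t : ℕ, (t : ℤ) = (a : ℕ) - β 0 := ⟨((a : ℕ) - β 0).toNat, by omega⟩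
      refine not_inZ_of_lt α t _ (by omega) (fun b hb => ?_) (h.tail ht)
      have h2 : (b : ℕ) ≤ a := (List.pairwise_cons.1 hα).1 b hb
      omega
  · rintro ⟨rfl, rfl⟩
    exact ⟨inZ_cons_self a γ, hcd⟩

/-- The fibres obey the same recursion as `pieriSet`. While the part exceeds the remainder, γ keeps
its head g and determines the entry a - g; once they are equal, β is forced to be (a, 0, …, 0). -/
theorem setZ_of_mem (α : List ℕ+) (hα : IsPartition α) :
    ∀ (s : ℕ) (γ : List ℕ+) (β : Fin α.length → ℤ), β ∈ setZ s α γ →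
      γ ∈ pieriSet s α ∧ (∀ i, 0 ≤ β i) ∧ ∀ β' ∈ setZ s α γ, β' = β := by
  induction α with
  | nil =>
    rintro s γ β ⟨h, hγ⟩
    have h1 : ∑ i : Fin 0, β i = s := h.sum_eq
    rw [Fin.sum_univ_zero] at h1
    have hs : s = 0 := by omega
    have : γ = [] := toInts_injective (hγ.symm.trans rfl)
    refine ⟨by simp [pieriSet, hs, this], fun i => Fin.elim0 i, fun β' _ => funext fun i =>
      Fin.elim0 i⟩
  | cons a α ih =>
    intro s γ β hβ
    obtain ⟨hp1, hp2⟩ := List.pairwise_cons.1 hα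
    rcases lt_trichotomy (a : ℕ) s with h | h | h
    · exfalso
      refine not_inZ_of_lt _ s β (by omega) (fun b hb => ?_) hβ.1
      rcases List.mem_cons.1 hb with rfl | hb
      · exact h
      · exact lt_of_le_of_lt (hp1 b hb) h
    · subst h
      obtain ⟨hβ1, rfl⟩ := (mem_setZ_self hα).1 hβ
      refine ⟨by simp [pieriSet], ?_, fun β' hβ' => ?_⟩
      · subst hβ1
        refine Fin.cases ?_ fun i => ?_
        · exact Int.natCast_nonneg _
        · exact le_rfl
      · rw [((mem_setZ_self hα).1 hβ').1, hβ1]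
    · obtain ⟨k, hk, g, γ', rfl, h1, h2, h3⟩ := (mem_setZ_of_lt h).1 hβ
      obtain ⟨i1, i2, i3⟩ := ih hp2 _ _ _ h3
      refine ⟨(mem_pieriSet_cons_of_lt h _).2 ⟨k, hk, g, γ', i1, rfl, h1⟩, ?_, fun β' hβ' => ?_⟩
      · refine Fin.cases ?_ fun i => ?_
        · exact h2.symm ▸ Int.natCast_nonneg k
        · exact i2 i
      · obtain ⟨k', hk', g', γ'', hγ, h1', h2', h3'⟩ := (mem_setZ_of_lt h).1 hβ'
        rw [List.cons.injEq] at hγ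
        obtain ⟨rfl, rfl⟩ := hγ
        obtain rfl : k = k' := by omega
        have h4 := i3 _ h3'
        funext i
        refine Fin.cases ?_ (fun i => ?_) i
        · exact h2'.trans h2.symm
        · exact congrFun h4 i

theorem setZ_nonempty (α : List ℕ+) (hα : IsPartition α) :
    ∀ (s : ℕ) (γ : List ℕ+), γ ∈ pieriSet s α → (setZ s α γ).Nonempty := by
  induction α with
  | nil =>
    intro s γ h
    rw [pieriSet] at h
    split_ifs at h with hs
    · rw [Finset.mem_singleton] at h
      subst hs h
      refine ⟨fun _ => 0, ?_, rfl⟩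
      constructor
      · rfl
      all_goals exact fun i => Fin.elim0 i
    · simp at h
  | cons a α ih =>
    intro s γ hγ
    obtain ⟨hp1, hp2⟩ := List.pairwise_cons.1 hα
    rcases lt_trichotomy (a : ℕ) s with h | h | h
    · simp [pieriSet, h] at hγ
    · subst h
      rw [pieriSet, if_neg (by omega), if_pos rfl, Finset.mem_singleton] at hγ
      exact ⟨_, (mem_setZ_self hα).2 ⟨rfl, hγ⟩⟩
    · rw [mem_pieriSet_cons_of_lt h] at hγ
      obtain ⟨k, hk, g, γ', h2, rfl, h3⟩ := hγ
      obtain ⟨β, hβ⟩ := ih hp2 _ _ h2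
      exact ⟨Fin.cons (k : ℤ) β, (mem_setZ_of_lt h).2 ⟨k, hk, g, γ', rfl, h3, rfl, hβ⟩⟩

theorem coeffC_eq (α : List ℕ+) (hα : IsPartition α) (s : ℕ) (γ : List ℕ+) :
    coeffC s α γ = if γ ∈ pieriSet s α then 1 else 0 := by
  rw [coeffC]
  split_ifs with h
  · obtain ⟨β, hβ⟩ := setZ_nonempty α hα s γ h
    obtain ⟨-, h1, h2⟩ := setZ_of_mem α hα s γ β hβ
    have : setZ s α γ = {β} := Set.eq_singleton_iff_unique_mem.2 ⟨hβ, h2⟩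
    rw [this, finsum_mem_singleton, sgn, Finset.filter_false_of_mem, Finset.card_empty, pow_zero]
    exact fun i _ => not_lt.2 (h1 i)
  · have : setZ s α γ = ∅ := by
      rw [Set.eq_empty_iff_forall_notMem]
      exact fun β hβ => h (setZ_of_mem α hα s γ β hβ).1
    rw [this, finsum_mem_empty]

/-! ### Linear independence of the immaculate functions -/

/-- The immaculate functions are unitriangular in the basis `H_α`, for the lexicographic order. -/
theorem pairing_immaculate (γ : List ℕ+) :
    ∀ δ, δ ≤ γ → pairing (immaculate (toInts γ)) (M δ) = if δ = γ then 1 else 0 := by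
  induction γ with
  | nil =>
    intro δ hδ
    have hδ' : δ = [] := by
      cases δ with
      | nil => rfl
      | cons d δ => exact absurd hδ (not_le.2 (List.nil_lt_cons d δ))
    rw [hδ', if_pos rfl, toInts_nil, immaculate_nil, ← completeH_nil, pairing_completeH_M,
      if_pos rfl]
  | cons a γ ih =>
    intro δ hδ
    have ha := a.pos
    rw [toInts_cons, immaculate_cons]
    obtain ⟨N, hN⟩ := exists_perpCol_eq_zero (immaculate (toInts γ))
    -- The i = 0 term is split off as the leading one; the others start with H_{a+i}, i ≥ 1, which
    -- no δ ≤ a :: γ can match.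
    rw [bernstein_eq_sum _ _ (N := N + 1) (fun i hi => hN i (by omega)), Finset.sum_range_succ',
      map_add, LinearMap.add_apply, map_sum, LinearMap.sum_apply]
    cases δ with
    | nil =>
      rw [if_neg (by simp), Finset.sum_eq_zero]
      · simp [pairing_H_mul_nil]
      · intro i _
        rw [map_smul, LinearMap.smul_apply, pairing_H_mul_nil, if_neg (by omega), smul_zero]
    | cons d δ =>
      have hda : d ≤ a := by
        by_contra hcon
        exact absurd hδ (not_le.2 (List.cons_lt_cons_iff.2 (Or.inl (not_le.1 hcon))))
      have hda' : (d : ℕ) ≤ a := hda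
      rw [Finset.sum_eq_zero, zero_add, pow_zero, one_smul, perpCol_zero, Nat.cast_zero, add_zero,
        pairing_H_mul_cons, if_neg (c := ((a : ℕ) : ℤ) = 0) (by omega), add_zero]
      · by_cases h : d = a
        · subst h
          have hδγ : δ ≤ γ := by
            by_contra hcon
            exact absurd hδ (not_le.2 (List.cons_lt_cons_iff.2 (Or.inr ⟨rfl, not_le.1 hcon⟩)))
          rw [if_pos rfl, ih δ hδγ]
          simp
        · have : ¬ (((a : ℕ) : ℤ) = (d : ℕ)) := by
            intro h'
            exact h (PNat.coe_injective (by omega))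
          rw [if_neg this, if_neg (by simp [h])]
      · intro i _
        rw [map_smul, LinearMap.smul_apply, pairing_H_mul_cons, if_neg (by push_cast; omega),
          if_neg (by omega), add_zero, smul_zero]

theorem linearIndependent_immaculate :
    LinearIndependent ℚ (fun γ : List ℕ+ => immaculate (toInts γ)) := by
  rw [linearIndependent_iff]
  intro l hl
  by_contra hne
  have hs : l.support.Nonempty := Finsupp.support_nonempty_iff.2 hne
  -- Pairing with M_μ for the lexicographically least μ kills every other term, leaving the
  -- coefficient of μ.
  set μ := l.support.min' hs with hμ
  have hμs : μ ∈ l.support := Finset.min'_mem _ _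
  have h1 : pairing (Finsupp.linearCombination ℚ (fun γ : List ℕ+ => immaculate (toInts γ)) l) (M μ)
      = l μ := by
    rw [Finsupp.linearCombination_apply, Finsupp.sum, map_sum, LinearMap.sum_apply,
      Finset.sum_eq_single_of_mem μ hμs]
    · rw [map_smul, LinearMap.smul_apply, pairing_immaculate μ μ le_rfl]
      simp
    · intro γ hγ hγμ
      rw [map_smul, LinearMap.smul_apply, pairing_immaculate γ μ (Finset.min'_le _ _ hγ),
        if_neg hγμ.symm, smul_zero]
  rw [hl, map_zero, LinearMap.zero_apply] at h1
  exact Finsupp.mem_support_iff.1 hμs h1.symm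

end NCSym

/-! ### The corollary -/

theorem mainTheorem3 (lam : List ℕ+) (hlam : IsPartition lam) (s : ℕ+) :
    (firstPart lam < s → perp (fundamental [s]) (immaculate (toInts lam)) = 0) ∧
    (firstPart lam = s →
      perp (fundamental [s]) (immaculate (toInts lam)) = immaculate (toInts lam.tail)) ∧
    ((s : ℕ) < firstPart lam →
      perp (fundamental [s]) (immaculate (toInts lam)) =
        ∑ γ ∈ compositions (size lam - s), coeffC s lam γ • immaculate (toInts γ) ∧
      ∀ γ ∈ compositions (size lam - s), coeffC s lam γ = 0 ∨ coeffC s lam γ = 1) ∧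
    LinearIndependent ℚ (fun γ : List ℕ+ => immaculate (toInts γ)) := by
  have hs := s.pos
  rw [fundamental_singleton]
  change (_ → perpRow s _ = _) ∧ (_ → perpRow s _ = _) ∧ (_ → perpRow s _ = _ ∧ _) ∧ _
  refine ⟨fun h => ?_, fun h => ?_, fun _ => ⟨?_, fun γ _ => ?_⟩, linearIndependent_immaculate⟩
  · refine perpRow_immaculate_of_lt lam hlam s hs fun b hb => ?_
    cases lam with
    | nil => simp at hb
    | cons a α =>
      rcases List.mem_cons.1 hb with rfl | hb
      · exact h
      · exact lt_of_le_of_lt ((List.pairwise_cons.1 hlam).1 b hb) h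
  · cases lam with
    | nil => exact absurd h hs.ne
    | cons a α =>
      obtain rfl : a = s := PNat.coe_injective h
      exact perpRow_immaculate_cons_self a α hlam
  · rw [perpRow_immaculate lam hlam]
    simp only [coeffC_eq lam hlam, ite_smul, one_smul, zero_smul]
    -- The sum over all compositions of |λ| - s reduces to `pieriSet`, whose members have that size.
    rw [← Finset.sum_filter]
    refine Finset.sum_congr ?_ fun _ _ => rfl
    ext γ
    rw [Finset.mem_filter, mem_compositions]
    refine ⟨fun h => ⟨?_, h⟩, fun h => h.2⟩
    have := size_of_mem_pieriSet lam s γ h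
    omega
  · rw [coeffC_eq lam hlam]
    split_ifs <;> simp
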